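/- Let $(A,\mathscr A,\mu)$ be a complete non-atomic measure space with $0<\mu(A)<\infty$, and let $(\Omega,\mathscr F,\mathbb P)$ be a probability space whose $\sigma$-algebra $\mathscr F$ is a finite set. For $\beta\in[0,1)$ and $\mathcal X\in L^\infty(\mathbb P)$ put $$\mathrm{VaR}_\beta(\mathcal X)=\inf\{x\in\mathbb R:\mathbb P(\mathcal X\le x)\ge 1-\beta\}.$$ Call a map $a\mapsto X_a$ from $A$ to $L^\infty(\mathbb P)$ an $\mathscr A$-measurable allocation if $a\mapsto\mathbb E^{\mathbb P}(X_a\mathcal Y)$ is $\mathscr A$-measurable for every $\mathcal Y\in L^1(\mathbb P)$. For $\mathcal X\in L^\infty(\mathbb P)$ let $\mathbb A(\mathcal X)$ be the set of those $\mathscr A$-measurable allocations for which $a\mapsto\mathbb E^{\mathbb P}(X_a\mathcal Y)$ is $\mu$-integrable with $\int_A\mathbb E^{\mathbb P}(X_a\mathcal Y)\,\mu(da)=\mathbb E^{\mathbb P}(\mathcal X\mathcal Y)$ for every $\mathcal Y\in L^1(\mathbb P)$ (that is, $\mathcal X$ is the Gelfand integral of $(X_a)_{a\in A}$ over $A$).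 Let $(\beta_a)_{a\in A}\in[0,1)^A$ be such that the family $(\mathrm{VaR}_{\beta_a})_{a\in A}$ is $\mathscr A$-measurable, i.e. $a\mapsto\mathrm{VaR}_{\beta_a}(X_a)$ is $\mathscr A$-measurable for every $\mathscr A$-measurable allocation $(X_a)_{a\in A}$. If $$\inf_{a\in A}\beta_a\ \ge\ \sup\{\mathbb P(C): C \text{ is a } \mathbb P\text{-atom}\},$$ then the integral infimal convolution of $(\mathrm{VaR}_{\beta_a})_{a\in A}$ is identically $-\infty$: for every $\mathcal X\in L^\infty(\mathbb P)$, $$\Big(\operatorname{\Box}_{a\in A}\mathrm{VaR}_{\beta_a}\,\mu(da)\Big)(\mathcal X)=\inf_{(X_a)_{a\in A}\in\mathbb A(\mathcal X)}\int_A\mathrm{VaR}_{\beta_a}(X_a)\,\mu(da)=-\infty .$$ Here $\int_A f\,d\mu=\int_A f^+\,d\mu-\int_A f^-\,d\mu\in[-\infty,\infty]$ for measurable $f:A\to\mathbb R$, with the convention $\int_A f\,d\mu=+\infty$ whenever $\int_A f^+\,d\mu=\infty$. -/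

import Mathlib

open MeasureTheory
open scoped ENNReal

namespace RiskSharing

/-- A measurable set `C` is an atom of `m` if it has positive measure and each of its measurable
subsets has measure `0` or the measure of `C`. -/
def IsMeasureAtom {S : Type*} [MeasurableSpace S] (m : Measure S) (C : Set S) : Prop :=
  MeasurableSet C ∧ 0 < m C ∧ ∀ B : Set S, MeasurableSet B → B ⊆ C → m B = 0 ∨ m B = m C

/-- A measure is non-atomic if it has no atoms. (Mathlib's `NoAtoms` only says that singletons are
null sets, which is a different condition on a general measurable space.) -/
def IsNonatomic {S : Type*} [MeasurableSpace S] (m : Measure S) : Prop :=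
  ∀ C : Set S, ¬ IsMeasureAtom m C

/-- The supremum of the measures of the atoms of `m`. -/
noncomputable def supAtomMeasure {S : Type*} [MeasurableSpace S] (m : Measure S) : ℝ≥0∞ :=
  ⨆ (C : Set S) (_ : IsMeasureAtom m C), m C

section

variable {A Ω : Type*} [MeasurableSpace A] [MeasurableSpace Ω]

/-- The pairing `E(X Y)` of a bounded payoff `X` with an integrable `Y`. -/
noncomputable def pairing (P : Measure Ω) (X : Lp ℝ ∞ P) (Y : Lp ℝ 1 P) : ℝ :=
  ∫ ω, X ω * Y ω ∂P

/-- An allocation `a ↦ X a` is measurable if `a ↦ E(X a Y)` is measurable for every integrable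
`Y`. -/
def IsMeasurableAllocation (P : Measure Ω) (X : A → Lp ℝ ∞ P) : Prop :=
  ∀ Y : Lp ℝ 1 P, Measurable fun a => pairing P (X a) Y

/-- A measurable allocation is Gelfand integrable if `a ↦ E(X a Y)` is integrable for every
integrable `Y`. -/
def IsGelfandIntegrable (μ : Measure A) (P : Measure Ω) (X : A → Lp ℝ ∞ P) : Prop :=
  IsMeasurableAllocation P X ∧ ∀ Y : Lp ℝ 1 P, Integrable (fun a => pairing P (X a) Y) μ

/-- `Z` is the Gelfand integral of the allocation `X` over `B`. -/
def IsGelfandIntegral (μ : Measure A) (P : Measure Ω) (X : A → Lp ℝ ∞ P) (B : Set A)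
    (Z : Lp ℝ ∞ P) : Prop :=
  ∀ Y : Lp ℝ 1 P, pairing P Z Y = ∫ a in B, pairing P (X a) Y ∂μ

/-- The allocation `X` is feasible for the total payoff `Z`. -/
def IsFeasible (μ : Measure A) (P : Measure Ω) (Z : Lp ℝ ∞ P) (X : A → Lp ℝ ∞ P) : Prop :=
  IsGelfandIntegrable μ P X ∧ IsGelfandIntegral μ P X Set.univ Z

/-- A family of functionals is measurable if it maps measurable allocations to measurable real
functions on the agent space. -/
def IsMeasurableFamily (P : Measure Ω) (ρ : A → Lp ℝ ∞ P → ℝ) : Prop :=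
  ∀ X : A → Lp ℝ ∞ P, IsMeasurableAllocation P X → Measurable fun a => ρ a (X a)

open Classical in
/-- The extended-real integral `∫ f⁺ - ∫ f⁻` of a (measurable) real function, with the convention
that it equals `+∞` whenever `∫ f⁺ = ∞` (even if `∫ f⁻ = ∞` as well). -/
noncomputable def extIntegral (μ : Measure A) (f : A → ℝ) : EReal :=
  if ∫⁻ a, ENNReal.ofReal (f a) ∂μ = ∞ then ⊤
  else ((∫⁻ a, ENNReal.ofReal (f a) ∂μ : ℝ≥0∞) : EReal)
    - ((∫⁻ a, ENNReal.ofReal (-f a) ∂μ : ℝ≥0∞) : EReal)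

/-- The integral infimal convolution of the family `ρ`: the least total risk
`∫ ρ a (X a) μ(da)` over the allocations `X` that are feasible for `Z`. -/
noncomputable def integralInfConv (μ : Measure A) (P : Measure Ω) (ρ : A → Lp ℝ ∞ P → ℝ)
    (Z : Lp ℝ ∞ P) : EReal :=
  ⨅ (X : A → Lp ℝ ∞ P) (_ : IsFeasible μ P Z X), extIntegral μ fun a => ρ a (X a)

/-- Value at risk at level `β`. For `β ∈ [0, 1)` the set below is non-empty and bounded below
(see `valueAtRisk_set_nonempty` and `valueAtRisk_set_bddBelow`), so that the infimum is genuine. -/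
noncomputable def valueAtRisk (P : Measure Ω) (β : ℝ) (X : Lp ℝ ∞ P) : ℝ :=
  sInf {x : ℝ | 1 - β ≤ P.real {ω | X ω ≤ x}}

theorem ae_abs_le_norm (P : Measure Ω) (X : Lp ℝ ∞ P) : ∀ᵐ ω ∂P, |X ω| ≤ ‖X‖ := by
  have h := Lp.eLpNorm_lt_top X
  filter_upwards [ae_le_eLpNormEssSup (f := X) (μ := P)] with ω hω
  rw [Lp.norm_def]
  rw [eLpNorm_exponent_top] at h ⊢
  have := ENNReal.toReal_mono h.ne hω
  simpa using this

theorem valueAtRisk_set_nonempty (P : Measure Ω) [IsProbabilityMeasure P] {β : ℝ} (hβ : 0 ≤ β)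
    (X : Lp ℝ ∞ P) : {x : ℝ | 1 - β ≤ P.real {ω | X ω ≤ x}}.Nonempty := by
  refine ⟨‖X‖, ?_⟩
  have h : P {ω | X ω ≤ ‖X‖} = 1 := by
    rw [← measure_univ (μ := P)]
    apply measure_congr
    filter_upwards [ae_abs_le_norm P X] with ω hω
    exact propext ⟨fun _ => trivial, fun _ => (abs_le.1 hω).2⟩
  simp only [Set.mem_ofPred_eq, Measure.real, h, ENNReal.toReal_one]
  linarith

theorem valueAtRisk_set_bddBelow (P : Measure Ω) {β : ℝ} (hβ : β < 1)
    (X : Lp ℝ ∞ P) : BddBelow {x : ℝ | 1 - β ≤ P.real {ω | X ω ≤ x}} := by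
  refine ⟨-‖X‖, fun x hx => ?_⟩
  by_contra hlt
  have h : P {ω | X ω ≤ x} = 0 := by
    rw [measure_eq_zero_iff_ae_notMem]
    filter_upwards [ae_abs_le_norm P X] with ω hω hmem
    have h1 := (abs_le.1 hω).1
    have h2 : X ω ≤ x := hmem
    exact hlt (h1.trans h2)
  simp only [Set.mem_ofPred_eq, Measure.real, h, ENNReal.toReal_zero] at hx
  linarith

end

end RiskSharing

open MeasureTheory
open scoped ENNReal

namespace RiskSharing

section MeasurableAtoms

variable {Ω : Type*} [MeasurableSpace Ω]

/-! A finite σ-algebra cuts Ω into cells of probability at most every `β a`, so the value at risk of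
agent `a` ignores the payoff on any one cell. Non-atomicity splits the agents into groups of
positive mass, one per cell. Every agent gives up a large constant `k` and is compensated only on
the cell of the group, where the compensation does not count. Total payoffs still add up to `Z`,
while total risk is at most `‖Z‖ - k * μ(A)`, which is arbitrarily negative. -/

theorem measurableSet_measurableAtom_of_finite (hfin : {s : Set Ω | MeasurableSet s}.Finite)
    (x : Ω) : MeasurableSet (measurableAtom x) := by
  have h : measurableAtom x = ⋂ s ∈ {s : Set Ω | MeasurableSet s ∧ x ∈ s}, s := by
    ext y
    simp only [measurableAtom, Set.mem_iInter, Set.mem_ofPred_eq]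
    exact ⟨fun h s hs => h s hs.2 hs.1, fun h s h1 h2 => h s ⟨h2, h1⟩⟩
  rw [h]
  exact (hfin.subset fun s hs => hs.1).measurableSet_biInter fun s hs => hs.1

theorem measurableAtom_eq_of_mem_of_finite (hfin : {s : Set Ω | MeasurableSet s}.Finite)
    {x y : Ω} (h : y ∈ measurableAtom x) : measurableAtom y = measurableAtom x := by
  refine (measurableAtom_subset (measurableSet_measurableAtom_of_finite hfin x) h).antisymm ?_
  refine measurableAtom_subset (measurableSet_measurableAtom_of_finite hfin y) ?_
  -- If `x` were outside the cell of `y`, the complement of that cell would be a measurable set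
  -- containing `x`, hence also `y`.
  by_contra hx
  exact (measurableAtom_subset (((measurableSet_measurableAtom_of_finite hfin y)).compl) hx h)
    (mem_measurableAtom_self y)

/-- A cell is either null or an atom of `m`: a nonempty measurable subset contains the cell of each
of its points, hence the whole cell. -/
theorem measure_measurableAtom_le_supAtomMeasure
    (hfin : {s : Set Ω | MeasurableSet s}.Finite) (m : Measure Ω) (x : Ω) :
    m (measurableAtom x) ≤ supAtomMeasure m := by
  rcases eq_or_ne (m (measurableAtom x)) 0 with h0 | h0
  · simp [h0]
  refine le_iSup₂_of_le (f := fun (C : Set Ω) (_ : IsMeasureAtom m C) => m C) (measurableAtom x)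
    ⟨measurableSet_measurableAtom_of_finite hfin x, pos_iff_ne_zero.2 h0, fun B hB hBx => ?_⟩ le_rfl
  rcases B.eq_empty_or_nonempty with rfl | ⟨y, hy⟩
  · exact Or.inl measure_empty
  · refine Or.inr (congrArg m (hBx.antisymm ?_))
    rw [← measurableAtom_eq_of_mem_of_finite hfin (hBx hy)]
    exact measurableAtom_subset hB hy

/-- A finite σ-algebra comes from a finite measurable partition, each cell of which has at most the
measure of the largest atom. -/
theorem exists_finite_partition_le_supAtomMeasure
    (hfin : {s : Set Ω | MeasurableSet s}.Finite) (m : Measure Ω) :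
    ∃ (n : ℕ) (C : Fin n → Set Ω), (∀ i, MeasurableSet (C i)) ∧ (∀ i, m (C i) ≤ supAtomMeasure m) ∧
      ∀ ω, ∑ i, (C i).indicator (fun _ => (1 : ℝ)) ω = 1 := by
  classical
  have hr : (Set.range (measurableAtom : Ω → Set Ω)).Finite :=
    hfin.subset (by rintro _ ⟨x, rfl⟩; exact measurableSet_measurableAtom_of_finite hfin x)
  have : Finite (Set.range (measurableAtom : Ω → Set Ω)) := hr
  obtain ⟨n, ⟨e⟩⟩ := Finite.exists_equiv_fin (Set.range (measurableAtom : Ω → Set Ω))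
  refine ⟨n, fun i => (e.symm i : Set Ω), fun i => ?_, fun i => ?_, fun ω => ?_⟩
  · obtain ⟨x, hx⟩ := (e.symm i).2
    simp only [← hx]
    exact measurableSet_measurableAtom_of_finite hfin x
  · obtain ⟨x, hx⟩ := (e.symm i).2
    simp only [← hx]
    exact measure_measurableAtom_le_supAtomMeasure hfin m x
  · rw [Finset.sum_eq_single (e ⟨measurableAtom ω, Set.mem_range_self ω⟩)]
    · simp [mem_measurableAtom_self]
    · intro i _ hi
      refine Set.indicator_of_notMem (fun hω => hi ?_) _
      obtain ⟨x, hx⟩ := (e.symm i).2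
      refine e.symm_apply_eq.1 (Subtype.ext ?_)
      simp only [← hx] at hω ⊢
      exact (measurableAtom_eq_of_mem_of_finite hfin hω).symm
    · simp

end MeasurableAtoms

section

variable {A Ω : Type*} [MeasurableSpace A] [MeasurableSpace Ω]

/-- If no such splitting existed, `S` itself would be an atom. -/
theorem IsNonatomic.exists_subset_pos {μ : Measure A} [IsFiniteMeasure μ] (hμ : IsNonatomic μ)
    {S : Set A} (hS : MeasurableSet S) (hpos : 0 < μ S) :
    ∃ B ⊆ S, MeasurableSet B ∧ 0 < μ B ∧ 0 < μ (S \ B) := by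
  by_contra! hcon
  refine hμ S ⟨hS, hpos, fun B hB hBS => ?_⟩
  rcases eq_or_ne (μ B) 0 with h0 | h0
  · exact Or.inl h0
  · have h := nonpos_iff_eq_zero.1 (hcon B hBS hB (pos_iff_ne_zero.2 h0))
    refine Or.inr ((measure_mono hBS).antisymm ?_)
    simpa [h] using measure_le_inter_add_sdiff μ S B |>.trans
      (add_le_add_left (measure_mono Set.inter_subset_right) _)

/-- A non-atomic measure space splits into any positive number of sets of positive measure. -/
theorem IsNonatomic.exists_measurable_fin {μ : Measure A} [IsFiniteMeasure μ] (hμ : IsNonatomic μ)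
    (hpos : 0 < μ Set.univ) (n : ℕ) :
    ∃ g : A → Fin (n + 1), Measurable g ∧ ∀ i, 0 < μ (g ⁻¹' {i}) := by
  classical
  induction n with
  | zero =>
    refine ⟨fun _ => 0, measurable_const, fun i => ?_⟩
    exact hpos.trans_le (measure_mono fun a _ => (Fin.fin_one_eq_zero i).symm)
  | succ n ih =>
    obtain ⟨g, hg, hgpos⟩ := ih
    obtain ⟨B, hBS, hB, hBpos, hdiff⟩ :=
      hμ.exists_subset_pos (hg (measurableSet_singleton 0)) (hgpos 0)
    -- The piece `B` of class 0 becomes the new class 0; old labels shift up by one, so the rest of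
    -- class 0 becomes class 1.
    refine ⟨fun a => if a ∈ B then 0 else (g a).succ,
      Measurable.ite hB measurable_const ((measurable_of_finite Fin.succ).comp hg), fun i => ?_⟩
    refine Fin.cases ?_ (fun j => ?_) i
    · exact hBpos.trans_le (measure_mono fun a ha => by simp [ha])
    · rcases eq_or_ne j 0 with rfl | hj
      · refine hdiff.trans_le (measure_mono fun a ha => ?_)
        have ha' : g a = 0 := ha.1
        simp [ha.2, ha']
      · refine (hgpos j).trans_le (measure_mono fun a ha => ?_)
        have ha' : g a = j := ha
        have hnot : a ∉ B := fun h => hj (ha'.symm.trans (hBS h))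
        simp [hnot, ha']

/-- As `c ≤ 0`, the positive part vanishes and the `+∞` convention never applies. -/
theorem extIntegral_le_of_forall_le {μ : Measure A} [IsFiniteMeasure μ] {f : A → ℝ} {c : ℝ}
    (hc : c ≤ 0) (hf : ∀ a, f a ≤ c) : extIntegral μ f ≤ ((c * μ.real Set.univ : ℝ) : EReal) := by
  have h0 : ∫⁻ a, ENNReal.ofReal (f a) ∂μ = 0 := by
    simp [fun a => ENNReal.ofReal_of_nonpos ((hf a).trans hc)]
  have h1 : ENNReal.ofReal (-c) * μ Set.univ ≤ ∫⁻ a, ENNReal.ofReal (-f a) ∂μ := by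
    rw [← lintegral_const]
    exact lintegral_mono fun a => ENNReal.ofReal_le_ofReal (neg_le_neg (hf a))
  have h2 : ENNReal.ofReal (-c) * μ Set.univ = ENNReal.ofReal (-c * μ.real Set.univ) := by
    rw [ENNReal.ofReal_mul (by linarith), ofReal_measureReal]
  have h3 : ((-c * μ.real Set.univ : ℝ) : EReal)
      ≤ ((∫⁻ a, ENNReal.ofReal (-f a) ∂μ : ℝ≥0∞) : EReal) := by
    refine le_trans ?_ (EReal.coe_ennreal_le_coe_ennreal_iff.2 (h2 ▸ h1))
    rw [EReal.coe_ennreal_ofReal]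
    exact EReal.coe_le_coe_iff.2 (le_max_left _ _)
  rw [extIntegral, h0, if_neg ENNReal.zero_ne_top, EReal.coe_ennreal_zero, zero_sub,
    EReal.neg_le]
  rwa [← EReal.coe_neg, ← neg_mul]

/-- Ignoring an event of probability at most `β`, an essential upper bound bounds the value at
risk. -/
theorem valueAtRisk_le_of_forall_notMem_le {P : Measure Ω} [IsProbabilityMeasure P] {β : ℝ}
    (hβ : β < 1) {C : Set Ω} (hC : MeasurableSet C) (hCβ : P.real C ≤ β) {X : Lp ℝ ∞ P} {c : ℝ}
    (hX : ∀ᵐ ω ∂P, ω ∉ C → X ω ≤ c) : valueAtRisk P β X ≤ c := by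
  refine csInf_le (valueAtRisk_set_bddBelow P hβ X) ?_
  calc 1 - β ≤ P.real Cᶜ := by rw [probReal_compl_eq_one_sub hC]; linarith
    _ ≤ P.real {ω | X ω ≤ c} :=
      ENNReal.toReal_mono (measure_ne_top _ _) (measure_mono_ae hX)

theorem pairing_toLp {P : Measure Ω} {w : Ω → ℝ} (hw : MemLp w ∞ P) (Y : Lp ℝ 1 P) :
    pairing P (hw.toLp w) Y = ∫ ω, w ω * Y ω ∂P :=
  integral_congr_ae (hw.coeFn_toLp.mono fun ω h => by simp only [h])

/-- An allocation that takes finitely many values according to a measurable label is feasible for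
the sum of the values weighted by the masses of the labels. -/
theorem isFeasible_comp {μ : Measure A} [IsFiniteMeasure μ] {P : Measure Ω} {ι : Type*} [Fintype ι]
    [MeasurableSpace ι] [DiscreteMeasurableSpace ι] {g : A → ι} (hg : Measurable g)
    {w : ι → Ω → ℝ} (hw : ∀ i, MemLp (w i) ∞ P) {Z : Lp ℝ ∞ P}
    (hZ : ∀ ω, Z ω = ∑ i, μ.real (g ⁻¹' {i}) * w i ω) :
    IsFeasible μ P Z fun a => (hw (g a)).toLp (w (g a)) := by
  have hint (φ : ι → ℝ) : Integrable (fun a => φ (g a)) μ :=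
    (integrable_map_measure (measurable_of_finite φ).aestronglyMeasurable hg.aemeasurable).1
      Integrable.of_finite
  refine ⟨⟨fun Y => ?_, fun Y => hint fun i => pairing P ((hw i).toLp (w i)) Y⟩, fun Y => ?_⟩
  · exact (measurable_of_finite fun i => pairing P ((hw i).toLp (w i)) Y).comp hg
  · have hY (i : ι) : Integrable (fun ω => w i ω * Y ω) P :=
      (hw i).integrable_mul (p := ∞) (q := 1) (Lp.memLp Y)
    -- Pushing `μ` forward to the finite label space turns the integral over agents into a finite
    -- weighted sum.
    have hmap : ∫ a, pairing P ((hw (g a)).toLp (w (g a))) Y ∂μ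
        = ∫ i, pairing P ((hw i).toLp (w i)) Y ∂(μ.map g) :=
      (integral_map hg.aemeasurable (f := fun i => pairing P ((hw i).toLp (w i)) Y)
        (measurable_of_finite _).aestronglyMeasurable).symm
    rw [setIntegral_univ, hmap, integral_fintype Integrable.of_finite]
    simp only [pairing_toLp, smul_eq_mul, map_measureReal_apply hg (measurableSet_singleton _),
      ← integral_const_mul]
    rw [← integral_finsetSum _ fun i _ => (hY i).const_mul _]
    refine integral_congr_ae (Filter.Eventually.of_forall fun ω => ?_)
    simp only [hZ ω, Finset.sum_mul, mul_assoc]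

end

end RiskSharing

theorem corollary4p3 {A Ω : Type*} [MeasurableSpace A] [MeasurableSpace Ω]
    (μ : Measure A) [IsFiniteMeasure μ] [μ.IsComplete] (hμ_pos : 0 < μ Set.univ)
    (hμ : RiskSharing.IsNonatomic μ)
    (P : Measure Ω) [IsProbabilityMeasure P] (hfin : {s : Set Ω | MeasurableSet s}.Finite)
    (β : A → ℝ) (hβ : ∀ a, β a ∈ Set.Ico (0 : ℝ) 1)
    (hmeas : RiskSharing.IsMeasurableFamily P fun a => RiskSharing.valueAtRisk P (β a))
    (hinf : RiskSharing.supAtomMeasure P ≤ ⨅ a, ENNReal.ofReal (β a)) :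
    ∀ Z : Lp ℝ ∞ P,
      RiskSharing.integralInfConv μ P (fun a => RiskSharing.valueAtRisk P (β a)) Z = ⊥ := by
  intro Z
  rw [EReal.eq_bot_iff_forall_lt]
  intro y
  obtain ⟨n, C, hC, hCsup, hCsum⟩ :=
    RiskSharing.exists_finite_partition_le_supAtomMeasure hfin P
  -- An empty partition would give `0 = 1` at any point of Ω.
  obtain _ | n := n
  · obtain ⟨ω⟩ := P.nonempty_of_neZero
    simpa using hCsum ω
  obtain ⟨g, hg, hgpos⟩ := hμ.exists_measurable_fin hμ_pos n
  set M := μ.real Set.univ with hM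
  set m : Fin (n + 1) → ℝ := fun i => μ.real (g ⁻¹' {i}) with hm
  have hMpos : 0 < M := ENNReal.toReal_pos hμ_pos.ne' (measure_ne_top _ _)
  have hmpos (i) : 0 < m i := ENNReal.toReal_pos (hgpos i).ne' (measure_ne_top _ _)
  have hmsum : ∑ i, m i = M := by
    have h := sum_measureReal_preimage_singleton (μ := μ) (f := g) Finset.univ
      fun i _ => hg (measurableSet_singleton i)
    simpa using h
  -- Chosen so that the risk bound `‖Z‖ - k * M` equals `-|y| - 1 < y`.
  set k := (|y| + ‖Z‖ + 1) / M with hk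
  -- Dividing by `m i` makes group `i` receive `k * M` in total on `C i`, which cancels the amount
  -- `k * M` given up there by all agents.
  let w : Fin (n + 1) → Ω → ℝ := fun i ω =>
    M⁻¹ * Z ω - k + k * M / m i * (C i).indicator (fun _ => 1) ω
  have hw (i) : MemLp (w i) ∞ P :=
    (((Lp.memLp Z).const_mul _).sub (memLp_const k)).add
      (((memLp_const (1 : ℝ)).indicator (hC i)).const_mul _)
  have hZ (ω) : Z ω = ∑ i, μ.real (g ⁻¹' {i}) * w i ω := by
    have h (i) : μ.real (g ⁻¹' {i}) * w i ω
        = m i * (M⁻¹ * Z ω - k) + k * M * (C i).indicator (fun _ => 1) ω := by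
      have := (hmpos i).ne'
      simp only [w, show μ.real (g ⁻¹' {i}) = m i from rfl]
      field_simp
    simp only [h, Finset.sum_add_distrib, ← Finset.sum_mul, ← Finset.mul_sum, hmsum, hCsum]
    field_simp
    ring
  have hcM : (M⁻¹ * ‖Z‖ - k) * M = -|y| - 1 := by
    rw [hk]
    field_simp
    ring
  have hc : M⁻¹ * ‖Z‖ - k ≤ 0 := by
    by_contra! h
    have := mul_pos h hMpos
    have := abs_nonneg y
    linarith
  refine (iInf₂_le _ (RiskSharing.isFeasible_comp hg hw hZ)).trans_lt ?_
  refine (RiskSharing.extIntegral_le_of_forall_le hc fun a => ?_).trans_lt ?_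
  · refine RiskSharing.valueAtRisk_le_of_forall_notMem_le (hβ a).2 (hC (g a)) ?_ ?_
    · exact ENNReal.toReal_le_of_le_ofReal (hβ a).1
        ((hCsup (g a)).trans (hinf.trans (iInf_le _ a)))
    · filter_upwards [(hw (g a)).coeFn_toLp, RiskSharing.ae_abs_le_norm P Z] with ω h1 h2 h3
      rw [h1]
      simp only [w, Set.indicator_of_notMem h3, mul_zero, add_zero]
      have := (abs_le.1 h2).2
      gcongr
  · rw [← hM, hcM, EReal.coe_lt_coe_iff]
    linarith [neg_abs_le y]
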